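/- Let $\mathcal T$ be a $\mathbb Z^n$-periodic triangulation of $\mathbb Z^n$: a collection of $n$-dimensional simplices in $\mathbb R^n$ which cover $\mathbb R^n$, whose set of vertices is $\mathbb Z^n$, such that the intersection of any two of them is a (possibly empty) face of both, and such that $\mathcal T + v = \mathcal T$ for every $v \in \mathbb Z^n$. For a simplex $S \in \mathcal T$ let $\operatorname{vol}(S)$ denote its relative volume, that is, $n!$ times the Lebesgue measure of $S$ divided by the volume of a fundamental domain of $\mathbb Z^n$ (which is $1$). Then for every $S \in \mathcal T$: (i) $\operatorname{vol}(S) \le n!$. (ii) If $\mathcal T$ is centrally symmetric, i.e. some point reflection $x \mapsto 2c - x$ of $\mathbb R^n$ maps $\mathcal T$ onto itself, then $$\operatorname{vol}(S) \le \frac{2^n}{\binom{2n}{n}}\, n!.$$ -/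

import Mathlib

open scoped Nat

/-- The lattice `ℤⁿ` in `ℝⁿ`: the integer span of the standard basis. -/
noncomputable def intLattice (n : ℕ) : Submodule ℤ (EuclideanSpace ℝ (Fin n)) :=
  Submodule.span ℤ (Set.range (EuclideanSpace.basisFun (Fin n) ℝ).toBasis)

/-- The image of a collection of simplices under a bijection of the ambient space. A simplex is
represented by the finite set of its vertices. -/
def imageCollection {n : ℕ} (f : EuclideanSpace ℝ (Fin n) ≃ EuclideanSpace ℝ (Fin n))
    (T : Set (Finset (EuclideanSpace ℝ (Fin n)))) : Set (Finset (EuclideanSpace ℝ (Fin n))) :=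
  (fun s => s.map f.toEmbedding) '' T

/-- `T` is a triangulation of `ℤⁿ`: a face-to-face tiling of `ℝⁿ` by `n`-dimensional simplices
whose vertex set is `ℤⁿ`. Each simplex is represented by the finite set of its vertices; the
simplex itself is the convex hull. (`T` is automatically countable.) -/
structure IsTriangulation {n : ℕ} (T : Set (Finset (EuclideanSpace ℝ (Fin n)))) : Prop where
  /-- every member has `n + 1` vertices -/
  card_eq : ∀ s ∈ T, s.card = n + 1
  /-- and these are affinely independent -/
  affineIndependent : ∀ s ∈ T, AffineIndependent ℝ ((↑) : s → EuclideanSpace ℝ (Fin n))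
  /-- the points that occur as vertices are exactly the integer points -/
  vertices_eq : (⋃ s ∈ T, (s : Set (EuclideanSpace ℝ (Fin n)))) = intLattice n
  /-- any two simplices meet in a common (possibly empty) face -/
  inter_isFace : ∀ s ∈ T, ∀ t ∈ T, ∃ u : Finset (EuclideanSpace ℝ (Fin n)), u ⊆ s ∧ u ⊆ t ∧
    convexHull ℝ (s : Set (EuclideanSpace ℝ (Fin n))) ∩ convexHull ℝ t = convexHull ℝ u
  /-- the simplices cover the space -/
  cover : (⋃ s ∈ T, convexHull ℝ (s : Set (EuclideanSpace ℝ (Fin n)))) = Set.univ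

/-- `T + v = T` for all `v ∈ ℤⁿ`. -/
def IsPeriodic {n : ℕ} (T : Set (Finset (EuclideanSpace ℝ (Fin n)))) : Prop :=
  ∀ v ∈ intLattice n, imageCollection (Equiv.addRight v) T = T

/-- Some point reflection `x ↦ 2c - x` maps `T` onto itself. -/
def IsCentrallySymmetric {n : ℕ} (T : Set (Finset (EuclideanSpace ℝ (Fin n)))) : Prop :=
  ∃ c : EuclideanSpace ℝ (Fin n), imageCollection (Equiv.pointReflection c) T = T

/-- The relative volume of an `n`-dimensional simplex with vertex set `s` with respect to an
`n`-dimensional lattice `L`: the number `k` such that the volume of the simplex is `k * V / n!`,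
where `V` is the fundamental volume of `L`. -/
noncomputable def relativeVolume {n : ℕ} (L : Submodule ℤ (EuclideanSpace ℝ (Fin n)))
    (s : Finset (EuclideanSpace ℝ (Fin n))) : ℝ :=
  MeasureTheory.volume.real (convexHull ℝ (s : Set (EuclideanSpace ℝ (Fin n)))) /
    (ZLattice.covolume L / (n ! : ℝ))

/-! Let `U` be the interior of a simplex `S` of the triangulation. Distinct members have disjoint
interiors and `T` is periodic, so the translates of `U` by lattice vectors are disjoint. Hence `U -
U` contains no nonzero lattice point. It is convex and symmetric, so Minkowski's theorem bounds its
volume by `2 ^ n` times the covolume (`Convex.measure_sub_le_of_packing`).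

Conversely, the difference body of a simplex has at least `(2 * n).choose n` times its volume
(`AffineBasis.choose_mul_volume_le`): an affine change of coordinates reduces this to the corner
simplex, where the volume is summed over orthants. Comparing the two gives the bound in (ii), and `2
^ n ≤ (2 * n).choose n` gives (i). -/

open MeasureTheory
open scoped Pointwise

/-- The open orthant of `ℝ^ι` whose positive coordinates are those in `I`. -/
def openOrthant {ι : Type*} (I : Finset ι) : Set (ι → ℝ) :=
  {x | (∀ i ∈ I, 0 < x i) ∧ ∀ i ∉ I, x i < 0}

/-- The interior of the standard corner simplex in `ℝ^ι`. -/
def openCornerSimplex (ι : Type*) [Fintype ι] : Set (ι → ℝ) :=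
  {x | (∀ i, 0 < x i) ∧ ∑ i, x i < 1}

/-- The difference body of the open corner simplex: positive and negative parts both have
coordinate sum less than one. -/
def cornerDifferenceBody (ι : Type*) [Fintype ι] : Set (ι → ℝ) :=
  {x | ∑ i, max (x i) 0 < 1 ∧ ∑ i, max (-x i) 0 < 1}

theorem openOrthant_disjoint {ι : Type*} {I J : Finset ι} (h : I ≠ J) :
    Disjoint (openOrthant I) (openOrthant J) := by
  rw [Set.disjoint_left]
  rintro x ⟨h1, h2⟩ ⟨h3, h4⟩
  refine h (Finset.ext fun i => ⟨fun hi => ?_, fun hi => ?_⟩)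
  · by_contra hj; linarith [h1 i hi, h4 i hj]
  · by_contra hj; linarith [h3 i hi, h2 i hj]

/-! ### Volumes of the corner simplex and its difference body -/

section Orthants

variable {ι : Type*} [Fintype ι]

theorem measurableSet_openOrthant (I : Finset ι) : MeasurableSet (openOrthant I) := by
  have : openOrthant I = (⋂ i ∈ I, {x : ι → ℝ | 0 < x i}) ∩ ⋂ i ∉ I, {x : ι → ℝ | x i < 0} := by
    ext x; simp [openOrthant]
  rw [this]
  refine MeasurableSet.inter ?_ ?_
  · exact MeasurableSet.iInter fun i => MeasurableSet.iInter fun _ =>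
      measurableSet_lt measurable_const (measurable_pi_apply i)
  · exact MeasurableSet.iInter fun i => MeasurableSet.iInter fun _ =>
      measurableSet_lt (measurable_pi_apply i) measurable_const

theorem ae_mem_iUnion_openOrthant :
    ∀ᵐ x : ι → ℝ, x ∈ ⋃ I ∈ (Finset.univ : Finset (Finset ι)), openOrthant I := by
  classical
  have h : ∀ i : ι, ∀ᵐ x : ι → ℝ, x i ≠ 0 := by
    intro i
    have := (Measure.quasiMeasurePreserving_eval (fun _ : ι => (volume : Measure ℝ)) i).ae
      (p := fun y => y ≠ 0) (by simp [ae_iff])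
    exact this
  filter_upwards [ae_all_iff.2 h] with x hx
  simp only [Finset.mem_univ, Set.iUnion_true, Set.mem_iUnion]
  refine ⟨Finset.univ.filter fun i => 0 < x i, fun i hi => by simpa using hi, fun i hi => ?_⟩
  exact lt_of_le_of_ne (by simpa using hi) (hx i)

theorem volume_eq_sum_openOrthant (X : Set (ι → ℝ)) (hX : MeasurableSet X) :
    volume X = ∑ I : Finset ι, volume (X ∩ openOrthant I) := by
  rw [← measure_biUnion_finset]
  · rw [← Set.inter_iUnion₂]
    refine measure_congr ?_
    filter_upwards [ae_mem_iUnion_openOrthant (ι := ι)] with x hx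
    exact propext ⟨fun h => ⟨h, hx⟩, fun h => h.1⟩
  · intro I _ J _ h
    exact (openOrthant_disjoint h).mono Set.inter_subset_right Set.inter_subset_right
  · exact fun I _ => hX.inter (measurableSet_openOrthant I)

theorem measurableSet_openCornerSimplex : MeasurableSet (openCornerSimplex ι) := by
  have : openCornerSimplex ι = (⋂ i, {x : ι → ℝ | 0 < x i}) ∩ {x | ∑ i, x i < 1} := by
    ext x; simp [openCornerSimplex]
  rw [this]
  exact (MeasurableSet.iInter fun i => measurableSet_lt measurable_const
    (measurable_pi_apply i)).inter (measurableSet_lt (by fun_prop) measurable_const)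

/-- Negating the coordinates outside `I` preserves volume and turns absolute values on this orthant
into coordinates. -/
theorem volume_crossPolytope_inter_openOrthant (I : Finset ι) :
    volume ({x : ι → ℝ | ∑ i, |x i| < 1} ∩ openOrthant I) = volume (openCornerSimplex ι) := by
  classical
  have hp : MeasurePreserving (fun (x : ι → ℝ) i => (if i ∈ I then id else Neg.neg : ℝ → ℝ) (x i))
      volume volume := by
    refine volume_preserving_pi fun i => ?_
    split_ifs
    · exact MeasurePreserving.id _
    · exact Measure.measurePreserving_neg volume
  rw [← hp.measure_preimage measurableSet_openCornerSimplex.nullMeasurableSet]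
  congr 1
  ext x
  have key : x ∈ openOrthant I ↔
      ∀ i, 0 < (if i ∈ I then id else Neg.neg : ℝ → ℝ) (x i) := by
    refine ⟨fun h i => ?_, fun h => ⟨fun i hi => ?_, fun i hi => ?_⟩⟩
    · split_ifs with hi
      · exact h.1 i hi
      · simpa using h.2 i hi
    · simpa [hi] using h i
    · simpa [hi] using h i
  have habs : x ∈ openOrthant I → ∀ i, |x i| = (if i ∈ I then id else Neg.neg : ℝ → ℝ) (x i) := by
    intro h i
    split_ifs with hi
    · exact abs_of_pos (h.1 i hi)
    · exact abs_of_neg (h.2 i hi)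
  constructor
  · rintro ⟨h1, h2⟩
    refine ⟨key.1 h2, ?_⟩
    rw [← Finset.sum_congr rfl fun i _ => habs h2 i]
    exact h1
  · rintro ⟨h1, h2⟩
    refine ⟨?_, key.2 h1⟩
    rw [← Finset.sum_congr rfl fun i _ => habs (key.2 h1) i] at h2
    exact h2

/-- The `ℓ¹` unit ball has volume `2 ^ n / n!` and splits, up to a null set, into `2 ^ n` reflected
copies of the corner simplex. -/
theorem volume_openCornerSimplex :
    volume (openCornerSimplex ι) = ((Fintype.card ι)! : ENNReal)⁻¹ := by
  have h1 := volume_sum_rpow_lt_one ι le_rfl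
  simp only [Real.rpow_one, div_one, Real.Gamma_nat_eq_factorial] at h1
  have hG : Real.Gamma (1 + 1) = 1 := by simpa using Real.Gamma_nat_eq_factorial 1
  have hm : MeasurableSet {x : ι → ℝ | ∑ i, |x i| < 1} :=
    measurableSet_lt (by fun_prop) measurable_const
  rw [hG, mul_one, volume_eq_sum_openOrthant _ hm,
    Finset.sum_congr rfl fun I _ => volume_crossPolytope_inter_openOrthant I, Finset.sum_const,
    Finset.card_univ, Fintype.card_finset, nsmul_eq_mul, div_eq_mul_inv,
    ENNReal.ofReal_mul (by positivity), ENNReal.ofReal_inv_of_pos (by positivity),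
    ENNReal.ofReal_natCast, ENNReal.ofReal_pow (by norm_num), ENNReal.ofReal_ofNat] at h1
  push_cast at h1
  exact (ENNReal.mul_right_inj (by positivity) (by finiteness)).1 h1

/-- On this orthant one constraint sees only the coordinates in `I` and the other only those
outside, so the piece is a product of two corner simplices, one negated. -/
theorem volume_cornerDifferenceBody_inter_openOrthant (I : Finset ι) :
    volume (cornerDifferenceBody ι ∩ openOrthant I) =
      ((I.card ! : ℕ) : ENNReal)⁻¹ * (((Fintype.card ι - I.card)! : ℕ) : ENNReal)⁻¹ := by
  classical
  have hp := volume_preserving_piEquivPiSubtypeProd (fun _ : ι => ℝ) (· ∈ I)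
  have hset : cornerDifferenceBody ι ∩ openOrthant I =
      MeasurableEquiv.piEquivPiSubtypeProd (fun _ : ι => ℝ) (· ∈ I) ⁻¹'
        (openCornerSimplex {i // i ∈ I} ×ˢ (-openCornerSimplex {i // i ∉ I})) := by
    ext x
    have hs : ∀ f : ι → ℝ, ∑ i, f i = ∑ i : {i // i ∈ I}, f i + ∑ i : {i // i ∉ I}, f i :=
      fun f => by
        rw [← Fintype.sum_subtype_add_sum_subtype (· ∈ I) f]
        congr!
    have h1 : x ∈ openOrthant I → ∑ i, max (x i) 0 = ∑ i : {i // i ∈ I}, x i := by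
      intro h
      rw [hs, Finset.sum_congr rfl fun i _ => max_eq_left (h.1 i.1 i.2).le,
        Finset.sum_congr rfl fun (i : {i // i ∉ I}) _ => max_eq_right (h.2 i.1 i.2).le]
      simp
    have h2 : x ∈ openOrthant I → ∑ i, max (-x i) 0 = ∑ i : {i // i ∉ I}, -x i := by
      intro h
      rw [hs, Finset.sum_congr rfl fun i _ =>
          max_eq_right (by linarith [h.1 i.1 i.2] : -x i.1 ≤ 0),
        Finset.sum_congr rfl fun (i : {i // i ∉ I}) _ =>
          max_eq_left (by linarith [h.2 i.1 i.2] : 0 ≤ -x i.1)]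
      simp
    constructor
    · rintro ⟨⟨h3, h4⟩, h5⟩
      rw [h1 h5] at h3
      rw [h2 h5] at h4
      exact ⟨⟨fun i => h5.1 i.1 i.2, h3⟩, ⟨fun i => neg_pos.2 (h5.2 i.1 i.2), h4⟩⟩
    · rintro ⟨⟨h3, h4⟩, ⟨h5, h6⟩⟩
      have h7 : x ∈ openOrthant I := ⟨fun i hi => h3 ⟨i, hi⟩, fun i hi => neg_pos.1 (h5 ⟨i, hi⟩)⟩
      exact ⟨⟨(h1 h7).trans_lt h4, (h2 h7).trans_lt h6⟩, h7⟩
  rw [hset, hp.measure_preimage_equiv, Measure.volume_eq_prod, Measure.prod_prod,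
    Measure.measure_neg, volume_openCornerSimplex]
  congr 1
  · convert volume_openCornerSimplex
    simp
  · simp [Fintype.card_subtype_compl]

/-- There are `n.choose k` orthants with `k` positive coordinates, each contributing `1 / (k! (n -
k)!) = n.choose k / n!`; the squares of the binomials sum to `(2 * n).choose n`. -/
theorem volume_cornerDifferenceBody :
    volume (cornerDifferenceBody ι) =
      ((2 * Fintype.card ι).choose (Fintype.card ι) : ENNReal) *
        ((Fintype.card ι)! : ENNReal)⁻¹ := by
  set n := Fintype.card ι with hn
  have hm : MeasurableSet (cornerDifferenceBody ι) := by
    refine MeasurableSet.inter (s₁ := {x : ι → ℝ | ∑ i, max (x i) 0 < 1})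
      (s₂ := {x : ι → ℝ | ∑ i, max (-x i) 0 < 1}) ?_ ?_ <;>
    exact measurableSet_lt (by fun_prop) measurable_const
  rw [volume_eq_sum_openOrthant _ hm,
    Finset.sum_congr rfl fun I _ => volume_cornerDifferenceBody_inter_openOrthant I,
    ← Nat.sum_range_choose_sq, ← Finset.powerset_univ,
    Finset.sum_powerset_apply_card
      (fun k => ((k ! : ℕ) : ENNReal)⁻¹ * (((Fintype.card ι - k)! : ℕ) : ENNReal)⁻¹),
    Finset.card_univ, ← hn, Nat.cast_sum, Finset.sum_mul]
  refine Finset.sum_congr rfl fun k hk => ?_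
  have hk' : k ≤ n := by simpa [Nat.lt_succ_iff] using hk
  have h0 : ∀ m : ℕ, ((m ! : ℕ) : ENNReal) ≠ 0 := fun m => by
    exact_mod_cast m.factorial_ne_zero
  have hc : ((n ! : ℕ) : ENNReal) = n.choose k * (k ! : ℕ) * ((n - k)! : ℕ) := by
    exact_mod_cast (Nat.choose_mul_factorial_mul_factorial hk').symm
  have hc0 : (n.choose k : ENNReal) ≠ 0 := by exact_mod_cast (Nat.choose_pos hk').ne'
  rw [hc, nsmul_eq_mul, ENNReal.mul_inv (.inr (by finiteness)) (.inr (h0 _)),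
    ENNReal.mul_inv (.inr (by finiteness)) (.inr (h0 _)), Nat.cast_pow, pow_two, mul_assoc,
    mul_assoc, ← mul_assoc (n.choose k : ENNReal) (n.choose k : ENNReal)⁻¹,
    ENNReal.mul_inv_cancel hc0 (by finiteness), one_mul]

end Orthants

/-- Write `x` as positive part minus negative part, then add the same small `ε` to every coordinate
of both so that they become strictly positive. -/
theorem cornerDifferenceBody_subset {ι : Type*} [Fintype ι] :
    cornerDifferenceBody ι ⊆ openCornerSimplex ι - openCornerSimplex ι := by
  rintro x ⟨h1, h2⟩
  have hshift : ∀ s : ℝ, s < 1 → ∃ ε > 0, s + Fintype.card ι * ε < 1 := by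
    intro s hs
    -- The `+ 1` keeps the inequality strict and covers empty `ι`.
    refine ⟨(1 - s) / (Fintype.card ι + 1), by have := sub_pos.2 hs; positivity, ?_⟩
    have h3 : (Fintype.card ι : ℝ) * ((1 - s) / (Fintype.card ι + 1)) < 1 - s := by
      rw [mul_div_assoc', div_lt_iff₀ (by positivity)]
      nlinarith
    linarith
  obtain ⟨ε, hε, h3⟩ := hshift _ (max_lt h1 h2)
  have hmem : ∀ y : ι → ℝ, ∑ i, max (y i) 0 ≤ max (∑ i, max (x i) 0) (∑ i, max (-x i) 0) →
      (fun i => max (y i) 0 + ε) ∈ openCornerSimplex ι := by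
    intro y hy
    refine ⟨fun i => by positivity, ?_⟩
    rw [Finset.sum_add_distrib, Finset.sum_const, nsmul_eq_mul, Finset.card_univ]
    linarith
  refine Set.mem_sub.2 ⟨_, hmem x (le_max_left _ _), _, hmem (fun i => -x i) (le_max_right _ _), ?_⟩
  ext i
  simp only [Pi.sub_apply]
  rcases le_total (x i) 0 with h | h
  · rw [max_eq_right h, max_eq_left (neg_nonneg.2 h)]; ring
  · rw [max_eq_left h, max_eq_right (neg_nonpos.2 h)]; ring

/-! ### Transfer to an arbitrary simplex -/

section DifferenceBody

variable {κ E : Type*} [Fintype κ] [DecidableEq κ] [NormedAddCommGroup E] [NormedSpace ℝ E]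

theorem AffineBasis.equivFun_basisOf_sub (b : AffineBasis κ ℝ E) (i₀ : κ) (q : E)
    (j : {j // j ≠ i₀}) : (b.basisOf i₀).equivFun (q - b i₀) j = b.coord j q := by
  have h : q - b i₀ = (b.basisOf i₀).equivFun.symm fun j => b.coord j q := by
    rw [Module.Basis.equivFun_symm_apply]
    simp only [AffineBasis.basisOf_apply, vsub_eq_sub]
    have h1 : q - b i₀ = ∑ i, b.coord i q • (b i - b i₀) := by
      simp only [smul_sub, Finset.sum_sub_distrib, ← Finset.sum_smul, b.sum_coord_apply_eq_one,
        one_smul, b.linear_combination_coord_eq_self]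
    rw [h1, ← Fintype.sum_subtype_add_sum_subtype (· ≠ i₀)]
    rw [add_eq_left]
    refine Finset.sum_eq_zero fun i _ => ?_
    rw [not_not.1 i.2, sub_self, smul_zero]
  rw [h, LinearEquiv.apply_symm_apply]

/-- Interior points are those with all barycentric coordinates positive; positivity of the one at
`i₀` says that the others sum to less than one. -/
theorem AffineBasis.mem_interior_convexHull_iff (b : AffineBasis κ ℝ E) (i₀ : κ) (q : E) :
    q ∈ interior (convexHull ℝ (Set.range b)) ↔
      (b.basisOf i₀).equivFun (q - b i₀) ∈ openCornerSimplex {j // j ≠ i₀} := by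
  rw [b.interior_convexHull]
  have h1 : ∑ j, (b.basisOf i₀).equivFun (q - b i₀) j = 1 - b.coord i₀ q := by
    have h2 := b.sum_coord_apply_eq_one q
    rw [← Fintype.sum_subtype_add_sum_subtype (· ≠ i₀)] at h2
    have h3 : ∑ i : {i // ¬ i ≠ i₀}, b.coord i q = b.coord i₀ q := by
      rw [Fintype.sum_eq_single ⟨i₀, by simp⟩]
      intro x hx
      exact absurd (Subtype.ext (not_not.1 x.2)) hx
    simp only [b.equivFun_basisOf_sub]
    linarith
  simp only [openCornerSimplex, Set.mem_ofPred_eq]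
  rw [h1]
  simp only [b.equivFun_basisOf_sub]
  refine ⟨fun h => ⟨fun j => h j, by linarith [h i₀]⟩, fun h i => ?_⟩
  rcases eq_or_ne i i₀ with rfl | hi
  · linarith [h.2]
  · exact h.1 ⟨i, hi⟩

variable [MeasurableSpace E] [BorelSpace E]

/-- The Rogers–Shephard identity for a simplex, as a lower bound. -/
theorem AffineBasis.choose_mul_volume_le (b : AffineBasis κ ℝ E) (μ : Measure E)
    [μ.IsAddHaarMeasure] {n : ℕ} (hn : Fintype.card κ = n + 1) :
    ((2 * n).choose n : ENNReal) * μ (convexHull ℝ (Set.range b)) ≤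
      μ (interior (convexHull ℝ (Set.range b)) - interior (convexHull ℝ (Set.range b))) := by
  have : FiniteDimensional ℝ E := b.finiteDimensional
  obtain ⟨i₀⟩ := b.nonempty
  have hcard : Fintype.card {j // j ≠ i₀} = n := by simp [hn]
  set C := convexHull ℝ (Set.range b)
  let f : E ≃L[ℝ] ({j // j ≠ i₀} → ℝ) := (b.basisOf i₀).equivFun.toContinuousLinearEquiv
  have hf : ∀ q, q ∈ interior C ↔ f (q - b i₀) ∈ openCornerSimplex {j // j ≠ i₀} :=
    b.mem_interior_convexHull_iff i₀
  -- By uniqueness of Haar measure, `f` scales volume by a constant, which cancels from the final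
  -- comparison.
  have hmap : ∀ X, μ (f ⁻¹' X) = (μ.map f).addHaarScalarFactor volume * volume X := by
    intro X
    have h := f.toHomeomorph.toMeasurableEquiv.map_apply (μ := μ) X
    have h2 := Measure.isAddLeftInvariant_eq_smul (μ.map f) volume
    change (μ.map f) X = μ (f ⁻¹' X) at h
    rw [← h]
    conv_lhs => rw [h2]
    rfl
  have hC : μ C = μ (f ⁻¹' openCornerSimplex {j // j ≠ i₀}) := by
    have hconv : Convex ℝ C := convex_convexHull ℝ _
    rw [← measure_interior_of_null_frontier (hconv.addHaar_frontier μ),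
      ← measure_preimage_add_right μ (b i₀)]
    congr 1
    ext v
    simp [hf]
  have hsub : f ⁻¹' cornerDifferenceBody {j // j ≠ i₀} ⊆ interior C - interior C := by
    intro v hv
    obtain ⟨y, hy, z, hz, hyz⟩ := Set.mem_sub.1 (cornerDifferenceBody_subset hv)
    refine Set.mem_sub.2 ⟨f.symm y + b i₀, by simpa [hf], f.symm z + b i₀, by simpa [hf], ?_⟩
    rw [add_sub_add_right_eq_sub, ← map_sub, hyz, f.symm_apply_apply]
  refine le_trans (le_of_eq ?_) (measure_mono hsub)
  rw [hC, hmap, hmap, volume_openCornerSimplex, volume_cornerDifferenceBody, hcard]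
  ring

end DifferenceBody

/-! ### Minkowski's theorem and auxiliary facts -/

/-- A set of points whose lattice translates have disjoint interiors has a small difference
body: Minkowski's theorem applied to the difference body. -/
theorem Convex.measure_sub_le_of_packing {E : Type*} [NormedAddCommGroup E] [NormedSpace ℝ E]
    [MeasurableSpace E] [BorelSpace E] [FiniteDimensional ℝ E] (μ : Measure E)
    [μ.IsAddHaarMeasure] {L : AddSubgroup E} [Countable L] {F : Set E}
    (fund : IsAddFundamentalDomain L F μ) {U : Set E} (hU : Convex ℝ U)
    (hL : ∀ v ∈ L, v ≠ 0 → Disjoint U (v +ᵥ U)) :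
    μ (U - U) ≤ μ F * 2 ^ Module.finrank ℝ E := by
  by_contra! h
  obtain ⟨v, hv, hvU⟩ := exists_ne_zero_mem_lattice_of_measure_mul_two_pow_lt_measure fund
    (fun x hx => by
      obtain ⟨y, hy, z, hz, rfl⟩ := Set.mem_sub.1 hx
      exact Set.mem_sub.2 ⟨z, hz, y, hy, (neg_sub y z).symm⟩) (hU.sub hU) h
  -- A nonzero lattice vector `v = y - z` puts `y` in both `U` and `v +ᵥ U`.
  obtain ⟨y, hy, z, hz, hyz⟩ := Set.mem_sub.1 hvU
  refine Set.disjoint_left.1 (hL v v.2 (by simpa using hv)) hy ?_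
  exact Set.mem_vadd_set.2 ⟨z, hz, by rw [vadd_eq_add, ← hyz, sub_add_cancel]⟩

/-- If vertex `i` were missing from `u`, the barycentric coordinate at `i` would vanish on the hull
of `u`, yet it is positive at `q`. -/
theorem AffineBasis.eq_range_of_mem_interior {κ E : Type*} [Fintype κ] [NormedAddCommGroup E]
    [NormedSpace ℝ E] (b : AffineBasis κ ℝ E) {q : E} {u : Set E} (hu : u ⊆ Set.range b)
    (hq : q ∈ interior (convexHull ℝ (Set.range b))) (hqu : q ∈ convexHull ℝ u) :
    u = Set.range b := by
  refine hu.antisymm ?_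
  rintro _ ⟨i, rfl⟩
  by_contra hi
  rw [b.interior_convexHull] at hq
  have h : convexHull ℝ u ⊆ b.coord i ⁻¹' {0} := by
    refine convexHull_min (fun x hx => ?_) ((convex_singleton 0).affine_preimage _)
    obtain ⟨j, rfl⟩ := hu hx
    have hij : i ≠ j := by rintro rfl; exact hi hx
    simp [b.coord_apply_ne hij]
  exact (hq i).ne' (h hqu)

/-- Translation by `v` adds `s.card • v` to the sum of the points. -/
theorem Finset.eq_zero_of_map_addRight_eq {E : Type*} [AddCommGroup E] [Module ℝ E] {s : Finset E}
    (hs : s.Nonempty) {v : E} (h : s.map (Equiv.addRight v).toEmbedding = s) : v = 0 := by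
  have h1 : ∑ x ∈ s, x = ∑ x ∈ s, x + s.card • v := by
    conv_lhs => rw [← h]
    simp [Finset.sum_add_distrib]
  have h2 : s.card • v = 0 := by simpa using h1
  rw [← Nat.cast_smul_eq_nsmul ℝ] at h2
  exact (smul_eq_zero.1 h2).resolve_left (by simpa using hs.ne_empty)

theorem two_pow_le_choose (n : ℕ) : 2 ^ n ≤ (2 * n).choose n := by
  rw [← Nat.sum_range_choose, ← Nat.sum_range_choose_sq]
  exact Finset.sum_le_sum fun k _ => Nat.le_self_pow two_ne_zero _

/-! ### Packing by the simplices of a triangulation -/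

/-- The vertices of a member of a triangulation, as an affine basis. -/
noncomputable def IsTriangulation.affineBasis {n : ℕ}
    {T : Set (Finset (EuclideanSpace ℝ (Fin n)))} (hT : IsTriangulation T)
    {s : Finset (EuclideanSpace ℝ (Fin n))} (hs : s ∈ T) :
    AffineBasis s ℝ (EuclideanSpace ℝ (Fin n)) :=
  ⟨(↑), hT.affineIndependent s hs, by
    rw [(hT.affineIndependent s hs).affineSpan_eq_top_iff_card_eq_finrank_add_one]
    simp [hT.card_eq s hs]⟩

theorem IsTriangulation.range_affineBasis {n : ℕ} {T : Set (Finset (EuclideanSpace ℝ (Fin n)))}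
    (hT : IsTriangulation T) {s : Finset (EuclideanSpace ℝ (Fin n))} (hs : s ∈ T) :
    Set.range (hT.affineBasis hs) = s :=
  Subtype.range_coe

/-- Distinct members of a triangulation have disjoint interiors. -/
theorem IsTriangulation.disjoint_interior {n : ℕ} {T : Set (Finset (EuclideanSpace ℝ (Fin n)))}
    (hT : IsTriangulation T) {s t : Finset (EuclideanSpace ℝ (Fin n))} (hs : s ∈ T) (ht : t ∈ T)
    (h : s ≠ t) : Disjoint (interior (convexHull ℝ (s : Set (EuclideanSpace ℝ (Fin n)))))
      (interior (convexHull ℝ (t : Set (EuclideanSpace ℝ (Fin n))))) := by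
  have key : ∀ s ∈ T, ∀ u ⊆ s, ∀ q ∈ interior (convexHull ℝ (s : Set (EuclideanSpace ℝ (Fin n)))),
      q ∈ convexHull ℝ (u : Set (EuclideanSpace ℝ (Fin n))) → u = s := by
    intro s hs u hu q hq hqu
    have hb := hT.range_affineBasis hs
    have := (hT.affineBasis hs).eq_range_of_mem_interior (u := u) (by rw [hb]; exact_mod_cast hu)
      (by rwa [hb]) hqu
    rw [hb] at this
    exact_mod_cast this
  rw [Set.disjoint_left]
  intro q hqs hqt
  -- A common interior point lies in the common face `u`, which must then be all of `s` and all of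
  -- `t`.
  obtain ⟨u, hus, hut, hu⟩ := hT.inter_isFace s hs t ht
  have hqu : q ∈ convexHull ℝ (u : Set (EuclideanSpace ℝ (Fin n))) :=
    hu ▸ ⟨interior_subset hqs, interior_subset hqt⟩
  exact h ((key s hs u hus q hqs hqu).symm.trans (key t ht u hut q hqt hqu))

theorem IsTriangulation.disjoint_vadd_interior {n : ℕ}
    {T : Set (Finset (EuclideanSpace ℝ (Fin n)))} (hT : IsTriangulation T) (hper : IsPeriodic T)
    {s : Finset (EuclideanSpace ℝ (Fin n))} (hs : s ∈ T) {v : EuclideanSpace ℝ (Fin n)}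
    (hv : v ∈ intLattice n) (hv0 : v ≠ 0) :
    Disjoint (interior (convexHull ℝ (s : Set (EuclideanSpace ℝ (Fin n)))))
      (v +ᵥ interior (convexHull ℝ (s : Set (EuclideanSpace ℝ (Fin n))))) := by
  have ht : s.map (Equiv.addRight v).toEmbedding ∈ T := by
    rw [← hper v hv]
    exact ⟨s, hs, rfl⟩
  have hne : s.Nonempty := Finset.card_pos.1 (by rw [hT.card_eq s hs]; exact n.succ_pos)
  have hst : s ≠ s.map (Equiv.addRight v).toEmbedding :=
    fun h => hv0 (Finset.eq_zero_of_map_addRight_eq hne h.symm)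
  have hcoe : ((s.map (Equiv.addRight v).toEmbedding : Finset _) :
      Set (EuclideanSpace ℝ (Fin n))) = v +ᵥ (s : Set (EuclideanSpace ℝ (Fin n))) := by
    ext x
    simp [Set.mem_vadd_set_iff_neg_vadd_mem, add_comm]
  have h := hT.disjoint_interior hs ht hst
  rwa [hcoe, convexHull_vadd, interior_vadd] at h

/-- The bound holds for every periodic triangulation, centrally symmetric or not. -/
theorem IsTriangulation.relativeVolume_le {n : ℕ} {T : Set (Finset (EuclideanSpace ℝ (Fin n)))}
    (hT : IsTriangulation T) (hper : IsPeriodic T) {s : Finset (EuclideanSpace ℝ (Fin n))}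
    (hs : s ∈ T) :
    relativeVolume (intLattice n) s ≤ 2 ^ n / ((2 * n).choose n : ℝ) * (n ! : ℝ) := by
  set B := (EuclideanSpace.basisFun (Fin n) ℝ).toBasis
  have fund : IsAddFundamentalDomain (intLattice n).toAddSubgroup (ZSpan.fundamentalDomain B)
      (volume : Measure (EuclideanSpace ℝ (Fin n))) := ZSpan.isAddFundamentalDomain' B volume
  have : DiscreteTopology (intLattice n) :=
    inferInstanceAs (DiscreteTopology (Submodule.span ℤ (Set.range B)))
  have : IsZLattice ℝ (intLattice n) :=
    inferInstanceAs (IsZLattice ℝ (Submodule.span ℤ (Set.range B)))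
  have : Countable (intLattice n).toAddSubgroup :=
    inferInstanceAs (Countable (Submodule.span ℤ (Set.range B)))
  have hcov : ZLattice.covolume (intLattice n) =
      volume.real (ZSpan.fundamentalDomain B) :=
    ZLattice.covolume_eq_measure_fundamentalDomain _ _ (ZSpan.isAddFundamentalDomain B volume)
  have hpos : 0 < ZLattice.covolume (intLattice n) := ZLattice.covolume_pos _ _
  have hb := hT.range_affineBasis hs
  have h1 := (hT.affineBasis hs).choose_mul_volume_le volume (n := n) (by simp [hT.card_eq s hs])
  rw [hb] at h1
  have h2 := Convex.measure_sub_le_of_packing volume fund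
    (U := interior (convexHull ℝ (s : Set (EuclideanSpace ℝ (Fin n)))))
    (convex_convexHull ℝ _).interior fun v hv hv0 => hT.disjoint_vadd_interior hper hs hv hv0
  rw [finrank_euclideanSpace_fin] at h2
  -- Finiteness allows the `ENNReal` inequality to pass to the reals.
  have hfin : volume (ZSpan.fundamentalDomain B) ≠ ⊤ :=
    (ZSpan.fundamentalDomain_isBounded B).measure_lt_top.ne
  have h3 := ENNReal.toReal_mono (by finiteness) (h1.trans h2)
  simp only [ENNReal.toReal_mul, ENNReal.toReal_natCast, ENNReal.toReal_pow,
    ENNReal.toReal_ofNat] at h3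
  change _ * volume.real _ ≤ volume.real _ * _ at h3
  rw [← hcov] at h3
  have hch : (0 : ℝ) < (2 * n).choose n := by exact_mod_cast Nat.choose_pos (by lia)
  have hf : (0 : ℝ) < n ! := by exact_mod_cast n.factorial_pos
  rw [relativeVolume, div_le_iff₀ (by positivity)]
  field_simp
  linarith

theorem proposition2p6 (n : ℕ) (T : Set (Finset (EuclideanSpace ℝ (Fin n))))
    (hT : IsTriangulation T) (hper : IsPeriodic T)
    (S : Finset (EuclideanSpace ℝ (Fin n))) (hS : S ∈ T) :
    relativeVolume (intLattice n) S ≤ (n ! : ℝ) ∧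
      (IsCentrallySymmetric T →
        relativeVolume (intLattice n) S ≤ 2 ^ n / ((2 * n).choose n : ℝ) * (n ! : ℝ)) := by
  have h := hT.relativeVolume_le hper hS
  refine ⟨h.trans ?_, fun _ => h⟩
  have hch : (0 : ℝ) < (2 * n).choose n := by exact_mod_cast Nat.choose_pos (by lia)
  refine mul_le_of_le_one_left (by positivity) ((div_le_one hch).2 ?_)
  exact_mod_cast two_pow_le_choose n
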